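/- Consider a synchronous system whose $n$ nodes are the vertices of a finite simple undirected graph $G=(V,E)$ known to all nodes. In the local broadcast model, every transmission of a node is received identically and correctly by all its neighbours in $G$ (and by no other node). At most $f$ nodes are Byzantine faulty and may behave arbitrarily, except that their transmissions are also local broadcasts. Each node has a binary input. A deterministic protocol solves Byzantine consensus on $G$ tolerating at most $f$ faults if, for every faulty set of at most $f$ nodes, all inputs and every behaviour of the faulty nodes: every non-faulty node decides on a binary output in finite time (termination), all non-faulty nodes decide on the same value (agreement), and the output of each non-faulty node is the input of some non-faulty node (validity). The graph $G$ is $k$-connected if $n>k$ and the removal of fewer than $k$ nodes does not disconnect it. **Theorem.** If $G$ has minimum degree at least $2f$ and is $(\lfloor 3f/2\rfloor+1)$-connected, then Byzantine consensus tolerating at most $f$ Byzantine faulty nodes is achievable on $G$ under the local broadcast model. Moreover, the following algorithm achieves it (in particular, the paths required in step (b) exist), for every order of the phases and every choice of the paths in step (b). Here paths are simple; a path *excludes* $F$ if none of its internal nodes is in $F$ (its endpoints may be in $F$). Each node $v$ keeps a value $\gamma_v\in\{0,1\}$, initially its input. There is one phase for each set $F\subseteq V$ with $|F|\le f$, in an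 order known to all nodes. (a) *Flooding, $n$ rounds.* In the first round $v$ transmits $(\gamma_v,\bot)$, where $\bot$ is the empty path; if a neighbour transmits no message with path $\bot$ in that round, $(1,\bot)$ is substituted. On receiving $(b,\Pi)$ from a neighbour $u$, node $v$ discards it if $\Pi$ followed by $u$ is not a path of $G$, or if $v$ already received from $u$ in this phase a message with path $\Pi$, or if $\Pi$ contains $v$; otherwise $v$ has received $b$ along $\Pi$ followed by $u$, and transmits $(b,\Pi\text{-}u)$ in the next round of the phase. (b) For each $u\in V$, node $v$ chooses a path $P_{uv}$ from $u$ to $v$ that excludes $F$. Let $Z_v$ be the set of $u$ such that $v$ received $0$ along $P_{uv}$ (where $v$ is deemed to have received $\gamma_v$ from itself), and $N_v=V\setminus Z_v$. (c) If $|Z_v\cap F|\le\lfloor f/2\rfloor$, let $A_v=N_v$ when $|N_v|>f$ and $A_v=Z_v$ otherwise; if $|Z_v\cap F|>\lfloor f/2\rfloor$, let $A_v=Z_v$ when $|Z_v|>f$ and $A_v=N_v$ otherwise. Let $B_v=V\setminus A_v$. If $v\in B_v$ and $v$ received in step (a) one and the same value $\delta$ along some $f+1$ paths from nodes of $A_v$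 to $v$ that exclude $F$ and pairwise share no node except $v$, then $\gamma_v:=\delta$ (if both values qualify, $\gamma_v:=0$). After all phases, $v$ outputs $\gamma_v$. -/

import Mathlib

universe u

namespace LocalBroadcast

/-- `G` is `k`-connected: it has more than `k` vertices, and removing fewer than `k` vertices
does not disconnect it. -/
def IsKConnected {V : Type u} [Fintype V] (G : SimpleGraph V) (k : ℕ) : Prop :=
  k < Fintype.card V ∧
    ∀ S : Finset V, S.card < k → (G.induce ((↑S : Set V)ᶜ)).Connected

/-! ### Synchronous protocols under local broadcast -/

/-- A deterministic synchronous protocol on the node set `V`: one state machine for every node.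
In each round a node makes one transmission, or stays silent (`none`), as a function of its state;
it then updates its state from what it has received from each of the nodes.  A node decides on `b`
when its output becomes `some b` for the first time.  (Several messages sent in one round are
encoded as one element of `Msg`.) -/
structure Protocol (V : Type u) where
  State : Type u
  Msg : Type u
  init : V → Bool → State
  send : V → State → Option Msg
  step : V → State → (V → Option Msg) → State
  output : V → State → Option Bool

namespace Protocol

variable {V : Type u}

/-- The transmission of node `v` in the current round: a faulty node transmits whatever the
adversary `a` prescribes, every other node follows the protocol.  There is one transmission per
node, not one per link. -/
noncomputable def transmit (P : Protocol V) (T : Finset V) (a : V → Option P.Msg)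
    (s : V → P.State) (v : V) : Option P.Msg :=
  open scoped Classical in if v ∈ T then a v else P.send v (s v)

/-- The states of the nodes after `t` rounds, on the graph `G`, with set of faulty nodes `T`,
inputs `x`, and `adv t` the transmissions of the faulty nodes in round `t`.  The transmission of
`w` is received identically by all neighbours of `w`, and by nobody else.  (The state that this
assigns to a faulty node is never used.) -/
noncomputable def run (P : Protocol V) (G : SimpleGraph V) (T : Finset V) (x : V → Bool)
    (adv : ℕ → V → Option P.Msg) : ℕ → V → P.State
  | 0 => fun v => P.init v (x v)
  | t + 1 => fun v =>
      P.step v (run P G T x adv t v) fun w =>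
        open scoped Classical in
        if G.Adj w v then P.transmit T (adv t) (run P G T x adv t) w else none

/-- Node `v` decides on `b`: the first output that it produces, after finitely many rounds,
is `b`. -/
def Decides (P : Protocol V) (G : SimpleGraph V) (T : Finset V) (x : V → Bool)
    (adv : ℕ → V → Option P.Msg) (v : V) (b : Bool) : Prop :=
  ∃ t, P.output v (P.run G T x adv t v) = some b ∧
    ∀ t' < t, P.output v (P.run G T x adv t' v) = none

/-- The protocol solves Byzantine consensus on `G` under local broadcast, tolerating at most `f`
faulty nodes: whatever the faulty set, the inputs, and the behaviour of the faulty nodes,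
termination, agreement and validity hold. -/
def SolvesConsensus (P : Protocol V) (G : SimpleGraph V) (f : ℕ) : Prop :=
  ∀ (T : Finset V), T.card ≤ f → ∀ (x : V → Bool) (adv : ℕ → V → Option P.Msg),
    (∀ v, v ∉ T → ∃ b, P.Decides G T x adv v b) ∧
    (∀ v w, v ∉ T → w ∉ T → ∀ b c,
      P.Decides G T x adv v b → P.Decides G T x adv w c → b = c) ∧
    (∀ v, v ∉ T → ∀ b, P.Decides G T x adv v b → ∃ w, w ∉ T ∧ x w = b)

end Protocol

/-- Byzantine consensus tolerating at most `f` faulty nodes is achievable on `G` under local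
broadcast. -/
def ConsensusAchievable {V : Type u} (G : SimpleGraph V) (f : ℕ) : Prop :=
  ∃ P : Protocol.{u} V, P.SolvesConsensus G f

/-! ### The phase algorithm -/

section Algorithm

variable {V : Type u}

/-- The path `p` excludes `X`: none of its internal nodes is in `X`. -/
def Excludes {G : SimpleGraph V} {v w : V} (p : G.Path v w) (X : Finset V) : Prop :=
  ∀ z ∈ p.1.support, z ≠ v → z ≠ w → z ∉ X

/-- The arbitrary choices left open by the algorithm: an order in which the candidate fault sets
are treated (each set of at most `f` nodes exactly once), and, for each candidate set `F` and all
nodes `v`, `w`, a path between `v` and `w` that excludes `F`. -/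
structure Choices (G : SimpleGraph V) (f : ℕ) where
  phases : List (Finset V)
  nodup : phases.Nodup
  mem_phases : ∀ F, F ∈ phases ↔ F.card ≤ f
  path : Finset V → ∀ v w : V, G.Path v w
  excludes : ∀ F, F.card ≤ f → ∀ v w, Excludes (path F v w) F

/-- A set of flooding messages `(b, Π)`, as a partial function from `Π` to `b`.  A path `Π` is
written as a list from its most recent node back to its originator, and `[]` is the empty path.
(Of several messages that a node sends with the same path, only the first one counts, so the
messages sent by a node in one round form a partial function.) -/
abbrev Flood (V : Type u) := List V → Option Bool

/-- The state of a node: the candidate sets of the current and of the later phases, the number of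
rounds completed in the current phase, the value `γ`, the values received so far in the current
phase (`received (u :: Π)` is the value received along the path `Π` extended by the neighbour `u`),
and the messages to be sent in the next round. -/
structure FloodState (V : Type u) where
  pending : List (Finset V)
  round : ℕ
  value : Bool
  received : Flood V
  outgoing : Flood V

/-- The only message is `(b, [])`. -/
def singleFlood (b : Bool) : Flood V
  | [] => some b
  | _ :: _ => none

/-- The state at the beginning of a phase with value `γ`: the node is deemed to have received `γ`
from itself, and is about to initiate the flooding of `γ`. -/
def startPhase (pending : List (Finset V)) (γ : Bool) : FloodState V where
  pending := pending
  round := 0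
  value := γ
  received := singleFlood γ
  outgoing := singleFlood γ

/-- The message with path `Π` that arrives from the neighbour `w`; if `w` does not initiate its
flooding in the first round of the phase, the default message `(1, [])` is substituted. -/
def incoming (s : FloodState V) (inbox : V → Option (Flood V)) (w : V) (p : List V) :
    Option Bool :=
  ((inbox w).bind fun m => m p).or (if s.round = 0 ∧ p = [] then some true else none)

/-- The messages that node `v` accepts in a round.  The message `(b, Π)` from the neighbour `u` is
discarded if `Π` extended by `u` is not a path of `G`, if `u` has already sent a message with path
`Π` in this phase, or if `Π` contains `v`; otherwise `v` has received `b` along `Π` extended by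
`u`. -/
noncomputable def accepted (G : SimpleGraph V) (v : V) (s : FloodState V)
    (inbox : V → Option (Flood V)) : Flood V
  | [] => none
  | w :: p =>
      open scoped Classical in
      if G.Adj w v ∧ ((w :: p).IsChain G.Adj ∧ (w :: p).Nodup) ∧ s.received (w :: p) = none ∧
          v ∉ p then
        incoming s inbox w p
      else none

/-- The values received by the end of a round. -/
noncomputable def receivedAfter (G : SimpleGraph V) (v : V) (s : FloodState V)
    (inbox : V → Option (Flood V)) : Flood V :=
  fun p => (s.received p).or (accepted G v s inbox p)

/-- The value that node `v` has received along the path `p` from the other endpoint `w` of `p`;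
the path is traversed from `v` to `w`, and `v` itself is dropped from it. -/
def valueAlong {G : SimpleGraph V} (received : Flood V) {v w : V} (p : G.Path v w) : Option Bool :=
  received p.1.support.tail

/-- The set `Z_v` of the nodes from which `v` has received `0` along the chosen path. -/
noncomputable def zeroSet [Fintype V] {G : SimpleGraph V} {f : ℕ} (c : Choices G f) (F : Finset V)
    (v : V) (received : Flood V) : Finset V :=
  open scoped Classical in
  Finset.univ.filter fun w => valueAlong received (c.path F v w) = some false

/-- The set `A_v`, as determined by `F` and `Z = Z_v`, where `N_v` is the complement of `Z_v`.
In all four cases `B_v` is the complement of `A_v`. -/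
noncomputable def sourceSet [Fintype V] (f : ℕ) (F Z : Finset V) : Finset V :=
  open scoped Classical in
  if (Z ∩ F).card ≤ f / 2 then
    if f < (Zᶜ).card then Zᶜ else Z
  else
    if f < Z.card then Z else Zᶜ

/-- Node `v` has received `δ` along `f + 1` paths that join it to nodes of `A`, exclude `F`, and
have pairwise no node in common except `v`. -/
def ReceivesOnDisjointPaths (G : SimpleGraph V) (f : ℕ) (F A : Finset V) (v : V)
    (received : Flood V) (δ : Bool) : Prop :=
  ∃ (w : Fin (f + 1) → V) (p : ∀ i, G.Path v (w i)),
    (∀ i, w i ∈ A ∧ Excludes (p i) F ∧ valueAlong received (p i) = some δ) ∧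
    ∀ i j, i ≠ j → ∀ z, z ∈ (p i).1.support → z ∈ (p j).1.support → z = v

/-- The value of node `v` at the end of the phase for `F`.  (If both values qualify, which may
happen only if some faulty node is not in `F`, the value `0` is taken.) -/
noncomputable def updatedValue [Fintype V] {G : SimpleGraph V} {f : ℕ} (c : Choices G f)
    (F : Finset V) (v : V) (γ : Bool) (received : Flood V) : Bool :=
  open scoped Classical in
  let A := sourceSet f F (zeroSet c F v received)
  if v ∉ A ∧ ReceivesOnDisjointPaths G f F A v received false then false
  else if v ∉ A ∧ ReceivesOnDisjointPaths G f F A v received true then true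
  else γ

/-- One round of the algorithm at node `v`.  A phase has `n` rounds, `n` the number of nodes; in
every round the messages accepted are forwarded in the next round, and the last round of a phase
is followed by the update of the value. -/
noncomputable def phaseStep [Fintype V] {G : SimpleGraph V} {f : ℕ} (c : Choices G f) (v : V)
    (s : FloodState V) (inbox : V → Option (Flood V)) : FloodState V :=
  match s.pending with
  | [] => s
  | F :: rest =>
      if s.round + 1 < Fintype.card V then
        { pending := F :: rest
          round := s.round + 1
          value := s.value
          received := receivedAfter G v s inbox
          outgoing := accepted G v s inbox }
      else
        startPhase rest (updatedValue c F v s.value (receivedAfter G v s inbox))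

/-- The phase algorithm: flooding, classification and update, once for every candidate fault set;
the value at the end of the last phase is the output. -/
noncomputable def phaseAlgorithm [Fintype V] {G : SimpleGraph V} {f : ℕ} (c : Choices G f) :
    Protocol.{u} V where
  State := FloodState V
  Msg := Flood V
  init := fun _ b => startPhase c.phases b
  send := fun _ s => if s.pending.isEmpty then none else some s.outgoing
  step := fun v s inbox => phaseStep c v s inbox
  output := fun _ s => if s.pending.isEmpty then some s.value else none

end Algorithm

end LocalBroadcast

/-!
Let `T` be the set of faulty nodes.  Two facts about the phases give consensus.

*A phase never introduces a new value* (`updatedValue_mem`).  A node that changes its value to `δ`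
has received `δ` on `f + 1` paths that are disjoint apart from the node itself.  One of them
contains no faulty node, and flooding on it delivers the true value of its other endpoint.  Hence validity,
and agreement persists once it has been reached.

*The phase whose candidate set is `T` reaches agreement* (`exists_forall_updatedValue_eq`).  On a
path whose internal nodes are non-faulty, a node receives what the other endpoint transmitted in the
first round, and local broadcast makes this one value `b w` for each endpoint `w`, faulty or not
(`floodInvariant_run`, `valueAlong_of_excludes`).  Therefore all non-faulty nodes compute the same
sets `Z` and `A`, and `b` is constant on `A`.  Non-faulty nodes of `A` keep this constant; all
others adopt it, provided that `f + 1` disjoint paths from `A` that exclude `T` reach them.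

These paths exist by the choice of `A` (`exists_isFan_sourceSet`).  Either the complement of `A` has
at most `f` nodes, and minimum degree `2 * f` leaves `f + 1` neighbours in `A`; or at most `f / 2`
nodes of `T` lie outside `A`, and then connectivity `f + f / 2 + 1` gives a fan of `f + 1` paths
avoiding them.  The fan version of Menger's theorem needed here (`IsKConnected.exists_isFan`) is
deduced from Hall's theorem: one matches every node with itself or with its successor on a path,
together with `f + 1` auxiliary elements that serve as sources and as sinks.  The matching is an
injective map, whose orbits from the sources are the disjoint paths.
-/

namespace LocalBroadcast

/-! ### Fans of disjoint paths -/

section Fans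

variable {V : Type u} {G : SimpleGraph V}

theorem IsKConnected.exists_walk [Fintype V] {k : ℕ} (h : IsKConnected G k) {S : Finset V}
    (hS : S.card < k) {v w : V} (hv : v ∉ S) (hw : w ∉ S) :
    ∃ p : G.Walk v w, ∀ z ∈ p.support, z ∉ S := by
  obtain ⟨p⟩ := (h.2 S hS).preconnected ⟨v, by simpa using hv⟩ ⟨w, by simpa using hw⟩
  refine ⟨p.map (SimpleGraph.Embedding.induce _).toHom, fun z hz => ?_⟩
  have hz' : z ∈ p.support.map (SimpleGraph.Embedding.induce (G := G) _).toHom := by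
    rw [← SimpleGraph.Walk.support_map]
    exact hz
  obtain ⟨y, -, rfl⟩ := List.mem_map.1 hz'
  exact fun hy => y.2 (Finset.mem_coe.2 hy)

/-- The admissible steps of a fan from `A` to `v` whose members are indexed by `ι`.  The elements
`Sum.inr i` serve both as sources, joined to the nodes of `A`, and as sinks, joined to the
neighbours of `v`.  A node may stay where it is (it is then on no member of the fan) or move to a
neighbour outside `A ∪ F ∪ {v}`, so that a member meets `A` and `F ∪ {v}` only where it starts. -/
def FanStep (G : SimpleGraph V) (A F : Finset V) (v : V) {ι : Type} : V ⊕ ι → V ⊕ ι → Prop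
  | .inr _, .inl a => a ∈ A
  | .inr _, .inr _ => False
  | .inl u, .inr _ => G.Adj u v
  | .inl u, .inl w => w = u ∨ (G.Adj u w ∧ w ∉ A ∧ w ∉ F ∧ w ≠ v)

/-- Hall's theorem provides a system of fan steps.  If a set `U` of nodes contains no neighbour
of `v`, then the nodes outside `U` that are in `A` or that can be reached by a step from `U`
separate `A` from `v` in `G - (F \ A)`; so connectivity makes them more than `f` in number, which
is Hall's condition. -/
theorem exists_injective_fanStep [Fintype V] [DecidableEq V] {k f : ℕ} (h : IsKConnected G k)
    {A F : Finset V} {v : V} (hvA : v ∉ A) (hvF : v ∉ F) (hA : f < A.card)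
    (hF : (F \ A).card + f < k) :
    ∃ τ : V ⊕ Fin (f + 1) → V ⊕ Fin (f + 1),
      Function.Injective τ ∧ ∀ x, FanStep G A F v x (τ x) := by
  classical
  refine (Fintype.all_card_le_filter_rel_iff_exists_injective (FanStep G A F v)).1 fun L => ?_
  set U := L.toLeft
  rw [← Finset.card_toLeft_add_card_toRight (u := L)]
  have hR : L.toRight.card ≤ f + 1 := by simpa using Finset.card_le_univ L.toRight
  -- Without sources in `L`, staying put suffices; a neighbour of `v` in `U` hits all sinks.
  rcases L.toRight.eq_empty_or_nonempty with hJ | ⟨j, hj⟩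
  · rw [hJ, Finset.card_empty, add_zero, ← Finset.card_map Function.Embedding.inl]
    refine Finset.card_le_card fun x hx => ?_
    obtain ⟨u, hu, rfl⟩ := Finset.mem_map.1 hx
    simp only [Finset.mem_filter, Finset.mem_univ, true_and]
    exact ⟨.inl u, Finset.mem_toLeft.1 hu, Or.inl rfl⟩
  rw [Finset.mem_toRight] at hj
  by_cases hb : ∃ b ∈ U, G.Adj b v
  · obtain ⟨b, hbU, hbv⟩ := hb
    calc U.card + L.toRight.card ≤ U.card + (Finset.univ : Finset (Fin (f + 1))).card := by
          simpa using hR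
      _ = (U.disjSum Finset.univ).card := (Finset.card_disjSum _ _).symm
      _ ≤ _ := Finset.card_le_card fun x hx => ?_
    simp only [Finset.mem_filter, Finset.mem_univ, true_and]
    rcases x with u | i
    · exact ⟨.inl u, Finset.mem_toLeft.1 (Finset.inl_mem_disjSum.1 hx), Or.inl rfl⟩
    · exact ⟨.inl b, Finset.mem_toLeft.1 hbU, hbv⟩
  push Not at hb
  set S : Finset V := {w | w ∉ U ∧ (w ∈ A ∨ ∃ u ∈ U, G.Adj u w ∧ w ∉ A ∧ w ∉ F ∧ w ≠ v)} with hSdef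
  have hUS : Disjoint U S := by
    rw [Finset.disjoint_left]
    intro w hw hw'
    exact (Finset.mem_filter.1 hw').2.1 hw
  have hScard : f < S.card := by
    by_contra! hS
    obtain ⟨a, haA, haS⟩ := Finset.exists_mem_notMem_of_card_lt_card (hS.trans_lt hA)
    have haU : a ∈ U := by
      by_contra haU
      exact haS (by simp [hSdef, haU, haA])
    have hcard : ((F \ A) ∪ S).card < k :=
      (Finset.card_union_le _ _).trans_lt (by omega)
    obtain ⟨p, hp⟩ := h.exists_walk hcard (v := a) (w := v) (by simp [haA, haS])
      (by simp [hvF, hSdef, hvA])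
    -- A walk that starts in `U` and avoids `S` and `F \ A` cannot leave `U` before it reaches `v`.
    have key : ∀ {x y : V} (q : G.Walk x y), y = v → (∀ z ∈ q.support, z ∉ (F \ A) ∪ S) →
        x ∈ U → x ≠ v → False := by
      intro x y q
      induction q with
      | nil => intro hy _ _ hne; exact hne hy
      | @cons x z y hxz q ih =>
        intro hy hq hx hne
        by_cases hzv : z = v
        · exact hb x hx (hzv ▸ hxz)
        refine ih hy (fun t ht => hq t (by simp [ht])) ?_ hzv
        have hz := hq z (by simp)
        simp only [Finset.mem_union, Finset.mem_sdiff, not_or, not_and, not_not, hSdef,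
          Finset.mem_filter, Finset.mem_univ, true_and, not_exists] at hz
        by_contra hzU
        have h1 := hz.2 hzU
        exact hzv (h1.2 x hx hxz h1.1 fun hzF => h1.1 (hz.1 hzF))
    exact key p rfl hp haU (fun h => hvA (h ▸ haA))
  calc U.card + L.toRight.card ≤ U.card + S.card := by omega
    _ = (U ∪ S).card := (Finset.card_union_of_disjoint hUS).symm
    _ = ((U ∪ S).map Function.Embedding.inl).card := (Finset.card_map _).symm
    _ ≤ _ := Finset.card_le_card fun x hx => ?_
  obtain ⟨w, hw, rfl⟩ := Finset.mem_map.1 hx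
  simp only [Finset.mem_filter, Finset.mem_univ, true_and]
  rcases Finset.mem_union.1 hw with hw | hw
  · exact ⟨.inl w, Finset.mem_toLeft.1 hw, Or.inl rfl⟩
  · obtain ⟨-, hwA | ⟨u, hu, hs⟩⟩ := (Finset.mem_filter.1 hw).2
    · exact ⟨.inr j, hj, hwA⟩
    · exact ⟨.inl u, Finset.mem_toLeft.1 hu, Or.inr hs⟩

/-- The nodes on the orbit that leaves the source `i`, up to the first sink. -/
inductive OnOrbit {ι : Type} (τ : V ⊕ ι → V ⊕ ι) (i : ι) : V → Prop
  | start {a : V} : τ (.inr i) = .inl a → OnOrbit τ i a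
  | step {u w : V} : OnOrbit τ i u → τ (.inl u) = .inl w → OnOrbit τ i w

theorem OnOrbit.index_eq {ι : Type} {τ : V ⊕ ι → V ⊕ ι} (hτ : Function.Injective τ) {i j : ι}
    {z : V} (hi : OnOrbit τ i z) (hj : OnOrbit τ j z) : i = j := by
  induction hi with
  | start h =>
    cases hj with
    | start h' => exact Sum.inr_injective (hτ (h.trans h'.symm))
    | step _ h' => exact absurd (hτ (h.trans h'.symm)) (by simp)
  | step _ h ih =>
    cases hj with
    | start h' => exact absurd (hτ (h.trans h'.symm)) (by simp)
    | step hu h' => exact ih (Sum.inl_injective (hτ (h.trans h'.symm)) ▸ hu)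

/-- By finiteness the orbit of a source reaches a sink: otherwise an injective `τ` would permute
the nodes of the orbit, although the first of them is the image of the source. -/
theorem OnOrbit.exists_sink [Finite V] {ι : Type} {τ : V ⊕ ι → V ⊕ ι} (hτ : Function.Injective τ)
    {i : ι} {a : V} (ha : τ (.inr i) = .inl a) : ∃ z j, OnOrbit τ i z ∧ τ (.inl z) = .inr j := by
  by_contra! h
  have hex : ∀ z : {z // OnOrbit τ i z}, ∃ w : {z // OnOrbit τ i z}, τ (.inl z.1) = .inl w.1 := by
    rintro ⟨z, hz⟩
    rcases hw : τ (.inl z) with w | j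
    · exact ⟨⟨w, hz.step hw⟩, rfl⟩
    · exact absurd hw (h z j hz)
  choose g hg using hex
  have hinj : Function.Injective g := fun x y hxy =>
    Subtype.ext (Sum.inl_injective (hτ (by rw [hg, hg, hxy])))
  obtain ⟨z, hz⟩ := Finite.injective_iff_surjective.1 hinj ⟨a, .start ha⟩
  have := hg z
  rw [hz, ← ha] at this
  exact absurd (hτ this) (by simp)

theorem OnOrbit.exists_walk {ι : Type} {τ : V ⊕ ι → V ⊕ ι} {A F : Finset V} {v : V}
    (hvA : v ∉ A) (hτ : ∀ x, FanStep G A F v x (τ x)) {i : ι} {z : V} (hz : OnOrbit τ i z) :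
    ∃ a ∈ A, ∃ p : G.Walk z a,
      ∀ y ∈ p.support, OnOrbit τ i y ∧ y ≠ v ∧ (y ≠ a → y ∉ F) := by
  induction hz with
  | @start a h =>
    have ha : a ∈ A := by simpa [h, FanStep] using hτ (.inr i)
    refine ⟨a, ha, .nil, ?_⟩
    simp only [SimpleGraph.Walk.support_nil, List.mem_singleton, forall_eq]
    exact ⟨.start h, fun e => hvA (e ▸ ha), fun e => absurd rfl e⟩
  | @step u w hu h ih =>
    obtain ⟨a, ha, p, hp⟩ := ih
    have hs : w = u ∨ (G.Adj u w ∧ w ∉ A ∧ w ∉ F ∧ w ≠ v) := by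
      simpa [h, FanStep] using hτ (.inl u)
    rcases hs with rfl | ⟨hadj, -, hwF, hwv⟩
    · exact ⟨a, ha, p, hp⟩
    · refine ⟨a, ha, .cons hadj.symm p, fun y hy => ?_⟩
      rcases List.mem_cons.1 (by simpa using hy) with rfl | hy
      · exact ⟨hu.step h, hwv, fun _ => hwF⟩
      · exact hp y hy

/-- A family of `f + 1` paths from `v` to nodes of `A` that exclude `F` and have pairwise no node
in common except `v`. -/
def IsFan {f : ℕ} (A F : Finset V) (v : V) (w : Fin (f + 1) → V) (p : ∀ i, G.Path v (w i)) :
    Prop :=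
  (∀ i, w i ∈ A ∧ Excludes (p i) F) ∧
    ∀ i j, i ≠ j → ∀ z, z ∈ (p i).1.support → z ∈ (p j).1.support → z = v

/-- The fan version of Menger's theorem, with the additional demand that the paths exclude `F`:
only the part of `F` outside `A` costs connectivity. -/
theorem IsKConnected.exists_isFan [Fintype V] [DecidableEq V] {k f : ℕ} (h : IsKConnected G k)
    {A F : Finset V} {v : V} (hvA : v ∉ A) (hvF : v ∉ F) (hA : f < A.card)
    (hF : (F \ A).card + f < k) :
    ∃ (w : Fin (f + 1) → V) (p : ∀ i, G.Path v (w i)), IsFan A F v w p := by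
  obtain ⟨τ, hinj, hτ⟩ := exists_injective_fanStep h hvA hvF hA hF
  have main : ∀ i : Fin (f + 1), ∃ (a : V) (p : G.Path v a), a ∈ A ∧ Excludes p F ∧
      ∀ y ∈ p.1.support, y ≠ v → OnOrbit τ i y := by
    intro i
    obtain ⟨a₀, ha₀⟩ : ∃ a, τ (.inr i) = .inl a := by
      have := hτ (.inr i)
      rcases hx : τ (.inr i) with a | j
      · exact ⟨a, rfl⟩
      · rw [hx] at this; exact this.elim
    obtain ⟨z, j, hz, hzj⟩ := OnOrbit.exists_sink hinj ha₀
    have hadj : G.Adj z v := by simpa [hzj, FanStep] using hτ (.inl z)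
    obtain ⟨a, ha, p, hp⟩ := hz.exists_walk hvA hτ
    have hsub : ∀ y ∈ (SimpleGraph.Walk.cons hadj.symm p).toPath.1.support, y ≠ v →
        y ∈ p.support := by
      intro y hy hyv
      have := SimpleGraph.Walk.support_bypass_subset_support _ hy
      rcases List.mem_cons.1 (by simpa using this) with h | h
      · exact absurd h hyv
      · exact h
    exact ⟨a, (SimpleGraph.Walk.cons hadj.symm p).toPath, ha,
      fun y hy hyv hya => (hp y (hsub y hy hyv)).2.2 hya,
      fun y hy hyv => (hp y (hsub y hy hyv)).1⟩
  choose w p hw hp horb using main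
  refine ⟨w, p, fun i => ⟨hw i, hp i⟩, fun i j hij z hzi hzj => ?_⟩
  by_contra hzv
  exact hij ((horb i z hzi hzv).index_eq hinj (horb j z hzj hzv))

theorem exists_isFan_of_neighbors [Fintype V] [DecidableEq V] [DecidableRel G.Adj] {f : ℕ}
    {A F : Finset V} {v : V} (h : f < (G.neighborFinset v ∩ A).card) :
    ∃ (w : Fin (f + 1) → V) (p : ∀ i, G.Path v (w i)), IsFan A F v w p := by
  obtain ⟨B, hB, hcard⟩ := Finset.exists_subset_card_eq (Nat.succ_le_of_lt h)
  let e := (Finset.equivFinOfCardEq hcard).symm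
  have hw : ∀ i, G.Adj v (e i).1 ∧ (e i).1 ∈ A := by
    intro i
    simpa using hB (e i).2
  refine ⟨fun i => (e i).1, fun i => SimpleGraph.Path.singleton (hw i).1,
    fun i => ⟨(hw i).2, fun z hz hzv hzw => ?_⟩, fun i j hij z hzi hzj => ?_⟩
  · simp [SimpleGraph.Path.singleton] at hz
    tauto
  · simp [SimpleGraph.Path.singleton] at hzi hzj
    rcases hzi with h | h
    · exact h
    rcases hzj with h' | h'
    · exact h'
    exact absurd (e.injective (Subtype.ext (h.symm.trans h'))) hij

theorem lt_card_sourceSet [Fintype V] {f : ℕ} (hn : 2 * f < Fintype.card V) (F Z : Finset V) :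
    f < (sourceSet f F Z).card := by
  classical
  have := Finset.card_add_card_compl Z
  unfold sourceSet
  split_ifs <;> first | assumption | (convert (show f < Zᶜ.card by omega)) | omega

/-- The rule that determines `A` makes the required fan available at every node outside `A` and
`F`: either `F` has at most `f / 2` nodes outside `A`, or `A` misses at most `f` nodes, and then a
node outside `A` has more than `f` neighbours in `A`. -/
theorem exists_isFan_sourceSet [Fintype V] [DecidableRel G.Adj] {f : ℕ}
    (hdeg : 2 * f ≤ G.minDegree) (hconn : IsKConnected G (3 * f / 2 + 1)) {F : Finset V}
    (hF : F.card ≤ f) (Z : Finset V) {v : V} (hvA : v ∉ sourceSet f F Z) (hvF : v ∉ F) :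
    ∃ (w : Fin (f + 1) → V) (p : ∀ i, G.Path v (w i)), IsFan (sourceSet f F Z) F v w p := by
  classical
  have hv : 2 * f ≤ G.degree v := hdeg.trans (G.minDegree_le_degree v)
  have hn : 2 * f < Fintype.card V := hv.trans_lt (G.degree_lt_card_verts v)
  have hA := lt_card_sourceSet hn F Z
  have hcases : (F \ sourceSet f F Z).card ≤ f / 2 ∨ (sourceSet f F Z)ᶜ.card ≤ f := by
    have h1 := Finset.card_sdiff_add_card_inter F Z
    have h2 : F \ Zᶜ = Z ∩ F := by ext; simp [and_comm]
    have h3 : (F ∩ Z).card = (Z ∩ F).card := by rw [Finset.inter_comm]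
    unfold sourceSet
    split_ifs with c1 c2 c2
    · left
      convert c1
    · right
      convert not_lt.1 c2
    · left
      have : ¬ (Z ∩ F).card ≤ f / 2 := by convert c1
      omega
    · right
      convert (show Zᶜᶜ.card ≤ f by simpa using c2)
  rcases hcases with h | h
  · exact hconn.exists_isFan hvA hvF hA (by omega)
  · apply exists_isFan_of_neighbors
    -- `v` is outside `A` and is not a neighbour of itself, so at most `f - 1` neighbours are lost.
    have hsub : G.neighborFinset v \ sourceSet f F Z ⊆ ((sourceSet f F Z)ᶜ).erase v := by
      intro x hx
      simp only [Finset.mem_sdiff, SimpleGraph.mem_neighborFinset] at hx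
      simp [hx.2, hx.1.ne']
    have h1 := Finset.card_le_card hsub
    have hvc : v ∈ (sourceSet f F Z)ᶜ := by simpa using hvA
    rw [Finset.card_erase_of_mem hvc] at h1
    have h2 := Finset.card_pos.2 ⟨v, hvc⟩
    have h3 := Finset.card_sdiff_add_card_inter (G.neighborFinset v) (sourceSet f F Z)
    rw [SimpleGraph.card_neighborFinset_eq_degree] at h3
    omega

theorem IsKConnected.exists_path_excludes [Fintype V] {k : ℕ} (h : IsKConnected G k)
    {F : Finset V} (hF : F.card < k) (v w : V) : ∃ p : G.Path v w, Excludes p F := by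
  classical
  obtain ⟨p, hp⟩ := h.exists_walk (S := (F.erase v).erase w) (v := v) (w := w)
    ((Finset.card_le_card ((Finset.erase_subset _ _).trans (Finset.erase_subset _ _))).trans_lt hF)
    (by simp) (by simp)
  refine ⟨p.toPath, fun z hz hzv hzw hzF => hp z
    (SimpleGraph.Walk.support_bypass_subset_support _ hz) (by simp [hzv, hzw, hzF])⟩

theorem nonempty_choices [Fintype V] {f : ℕ} (hconn : IsKConnected G (3 * f / 2 + 1)) :
    Nonempty (Choices G f) := by
  classical
  have hpath : ∀ (F : Finset V) (v w : V), ∃ p : G.Path v w, F.card ≤ f → Excludes p F := by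
    intro F v w
    by_cases hF : F.card ≤ f
    · obtain ⟨p, hp⟩ := hconn.exists_path_excludes (show F.card < 3 * f / 2 + 1 by omega) v w
      exact ⟨p, fun _ => hp⟩
    · obtain ⟨p, -⟩ := hconn.exists_path_excludes (F := ∅) (by simp) v w
      exact ⟨p, fun h => absurd h hF⟩
  choose path hpath using hpath
  exact ⟨{
    phases := (Finset.univ.filter fun F : Finset V => F.card ≤ f).toList
    nodup := Finset.nodup_toList _
    mem_phases := by simp
    path := path
    excludes := fun F hF v w => hpath F v w hF }⟩

end Fans

/-! ### Flooding along routes with non-faulty relays -/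

section Flooding

variable {V : Type u} {G : SimpleGraph V}

/-- `p` lists, from the most recent node back to the originator, a path of `G` along which a
message reaches `v`, and all nodes of `p` that relay the message are outside `T`.  The originator
may be in `T`. -/
def IsRoute (G : SimpleGraph V) (T : Finset V) (v : V) (p : List V) : Prop :=
  (v :: p).IsChain G.Adj ∧ (v :: p).Nodup ∧ ∀ z ∈ p.dropLast, z ∉ T

theorem IsRoute.of_cons {T : Finset V} {v w : V} {p : List V} (h : IsRoute G T v (w :: p))
    (hp : p ≠ []) : w ∉ T ∧ IsRoute G T w p := by
  obtain ⟨h1, h2, h3⟩ := h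
  rw [List.dropLast_cons_of_ne_nil hp] at h3
  exact ⟨h3 w (by simp), (List.isChain_cons_cons.1 h1).2, (List.nodup_cons.1 h2).2,
    fun z hz => h3 z (by simp [hz])⟩

theorem isRoute_of_excludes {T : Finset V} {v w : V} (p : G.Path v w) (h : Excludes p T) :
    IsRoute G T v p.1.support.tail := by
  have hs := p.1.cons_tail_support
  refine ⟨hs ▸ p.1.isChain_adj_support, hs ▸ p.2.support_nodup, fun z hz => ?_⟩
  have hnd : (v :: p.1.support.tail).Nodup := hs ▸ p.2.support_nodup
  have hzt : z ∈ p.1.support.tail := List.dropLast_subset _ hz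
  have hne : p.1.support.tail ≠ [] := List.ne_nil_of_mem hzt
  refine h z (List.mem_of_mem_tail hzt) (fun e => (List.nodup_cons.1 hnd).1 (e ▸ hzt)) fun e => ?_
  have hlast : p.1.support.tail.getLast hne = w := by
    rw [List.getLast_tail, p.1.getLast_support]
  have hsplit := List.dropLast_append_getLast hne
  have hnd' := (List.nodup_cons.1 hnd).2
  rw [← hsplit, List.nodup_append] at hnd'
  exact hnd'.2.2 z hz _ (by simp) (e.trans hlast.symm)

/-- The state of node `v` after `r` rounds of a phase that began with the values `γ`, as far as it
does not depend on what the nodes of `T` do after the first round.  Here `b w` is the value that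
`w` initiates in the first round.  A message on a route with non-faulty relays arrives in the round
whose number is the length of the route, and carries the value of its originator. -/
structure FloodInvariant (G : SimpleGraph V) (T : Finset V) (γ b : V → Bool)
    (pending : List (Finset V)) (r : ℕ) (v : V) (s : FloodState V) : Prop where
  pending_eq : s.pending = pending
  round_eq : s.round = r
  value_eq : s.value = γ v
  received_nil : s.received [] = some (γ v)
  received_route : ∀ p (hp : p ≠ []), IsRoute G T v p →
    s.received p = if p.length ≤ r then some (b (p.getLast hp)) else none
  outgoing_route : ∀ p (hp : p ≠ []), IsRoute G T v p →
    s.outgoing p = if p.length = r then some (b (p.getLast hp)) else none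

theorem floodInvariant_startPhase (T : Finset V) (γ b : V → Bool) (pending : List (Finset V))
    (v : V) : FloodInvariant G T γ b pending 0 v (startPhase pending (γ v)) where
  pending_eq := rfl
  round_eq := rfl
  value_eq := rfl
  received_nil := rfl
  received_route p hp _ := by
    cases p with
    | nil => exact absurd rfl hp
    | cons => simp [startPhase, singleFlood]
  outgoing_route p hp _ := by
    cases p with
    | nil => exact absurd rfl hp
    | cons => simp [startPhase, singleFlood]

/-- What `v` finds in its inbox in round `r`, as far as it does not depend on what the nodes of `T`
do after the first round.  In `first`, `getD true` is the substitution of `1` for a missing message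
with the empty path. -/
structure InboxInvariant (G : SimpleGraph V) (T : Finset V) (b : V → Bool) (r : ℕ) (v : V)
    (inbox : V → Option (Flood V)) : Prop where
  first : r = 0 → ∀ w, G.Adj w v → ((inbox w).bind fun m => m []).getD true = b w
  relay : ∀ w, G.Adj w v → w ∉ T → ∀ p (hp : p ≠ []), IsRoute G T w p →
    ((inbox w).bind fun m => m p) = if p.length = r then some (b (p.getLast hp)) else none

theorem accepted_route {T : Finset V} {γ b : V → Bool} {pending : List (Finset V)} {r : ℕ} {v : V}
    {s : FloodState V} {inbox : V → Option (Flood V)} (hs : FloodInvariant G T γ b pending r v s)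
    (hin : InboxInvariant G T b r v inbox) (p : List V) (hp : p ≠ []) (hr : IsRoute G T v p) :
    accepted G v s inbox p = if p.length = r + 1 then some (b (p.getLast hp)) else none := by
  cases p with
  | nil => exact absurd rfl hp
  | cons w p =>
    have hadj : G.Adj w v := (List.isChain_cons_cons.1 hr.1).1.symm
    have hchain := (List.isChain_cons_cons.1 hr.1).2
    have hnd := List.nodup_cons.1 hr.2.1
    have hvp : v ∉ p := fun h => hnd.1 (List.mem_cons_of_mem _ h)
    have hrec := hs.received_route _ hp hr
    have hacc : accepted G v s inbox (w :: p) =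
        if s.received (w :: p) = none then incoming s inbox w p else none := by
      simp [accepted, hadj, hchain, hnd.2, hvp]
    rw [hacc, hrec]
    by_cases hle : (w :: p).length ≤ r
    · rw [if_pos hle, if_neg (by simp), if_neg (by omega)]
    rw [if_neg hle, if_pos rfl, incoming, hs.round_eq]
    by_cases hpn : p = []
    · subst hpn
      obtain rfl : r = 0 := by simpa using hle
      have hfirst := hin.first rfl w hadj
      cases hm : (inbox w).bind fun m => m [] <;> simp_all
    · obtain ⟨hwT, hr'⟩ := hr.of_cons hpn
      rw [hin.relay w hadj hwT p hpn hr']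
      simp [hpn, List.getLast_cons hpn]

theorem receivedAfter_nil {v : V} {s : FloodState V} {inbox : V → Option (Flood V)} :
    receivedAfter G v s inbox [] = s.received [] := by
  simp [receivedAfter, accepted]

theorem receivedAfter_route {T : Finset V} {γ b : V → Bool} {pending : List (Finset V)} {r : ℕ}
    {v : V} {s : FloodState V} {inbox : V → Option (Flood V)}
    (hs : FloodInvariant G T γ b pending r v s) (hin : InboxInvariant G T b r v inbox)
    (p : List V) (hp : p ≠ []) (hr : IsRoute G T v p) :
    receivedAfter G v s inbox p =
      if p.length ≤ r + 1 then some (b (p.getLast hp)) else none := by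
  rw [receivedAfter, hs.received_route p hp hr, accepted_route hs hin p hp hr]
  split_ifs <;> first | rfl | omega

/-- A path that excludes the faulty nodes delivers the value that its other endpoint initiated,
even if that endpoint is faulty. -/
theorem valueAlong_of_excludes [Fintype V] {T : Finset V} {b : V → Bool} {v : V} {R : Flood V}
    (hnil : R [] = some (b v))
    (hR : ∀ p (hp : p ≠ []), IsRoute G T v p → p.length ≤ Fintype.card V →
      R p = some (b (p.getLast hp)))
    {w : V} (p : G.Path v w) (h : Excludes p T) : valueAlong R p = some (b w) := by
  unfold valueAlong
  by_cases hne : p.1.support.tail = []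
  · have hw := p.1.end_mem_support
    rw [← p.1.cons_tail_support, hne] at hw
    rw [hne, hnil, List.mem_singleton.1 hw]
  · have hlen : p.1.support.tail.length ≤ Fintype.card V :=
      (p.2.support_nodup.sublist (List.tail_sublist _)).length_le_card
    rw [hR _ hne (isRoute_of_excludes p h) hlen, List.getLast_tail, p.1.getLast_support]

end Flooding

/-! ### One phase -/

section Phase

variable {V : Type u} {G : SimpleGraph V} {f : ℕ}

/-- The value that node `w` initiates in a phase: its own value, or, at a faulty node, what the
adversary transmits with the empty path in the first round, `1` being substituted for silence. -/
noncomputable def initiated (T : Finset V) (γ : V → Bool) (a : V → Option (Flood V)) (w : V) :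
    Bool :=
  open scoped Classical in if w ∈ T then ((a w).bind fun m => m []).getD true else γ w

theorem initiated_of_notMem {T : Finset V} {γ : V → Bool} {a : V → Option (Flood V)} {w : V}
    (h : w ∉ T) : initiated T γ a w = γ w := by
  simp [initiated, h]

/-- A node that receives `δ` on `f + 1` disjoint paths receives it on a path without faulty nodes,
hence from a non-faulty node that holds `δ`. -/
theorem ReceivesOnDisjointPaths.exists_initiated {T F A : Finset V} {b : V → Bool} {R : Flood V}
    {v : V} {δ : Bool} (hT : T.card ≤ f) (hv : v ∉ T)
    (hR : ∀ w (p : G.Path v w), Excludes p T → valueAlong R p = some (b w))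
    (h : ReceivesOnDisjointPaths G f F A v R δ) :
    ∃ w ∉ T, b w = δ := by
  obtain ⟨w, p, hp, hdis⟩ := h
  have hfree : ∃ i, ∀ z ∈ (p i).1.support, z ∉ T := by
    by_contra! hcon
    choose z hz hzT using hcon
    have hinj : Function.Injective z := by
      intro i j hij
      by_contra hne
      exact hv (hdis i j hne (z i) (hz i) (hij ▸ hz j) ▸ hzT i)
    have := Finset.card_le_card_of_injOn z (s := Finset.univ) (t := T)
      (fun i _ => hzT i) hinj.injOn
    simp at this
    omega
  obtain ⟨i, hi⟩ := hfree
  refine ⟨w i, hi _ (p i).1.end_mem_support, ?_⟩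
  have := hR (w i) (p i) fun z hz _ _ => hi z hz
  rw [(hp i).2.2] at this
  exact (Option.some_injective _ this).symm

variable [Fintype V]

/-- The states of the nodes after `t` rounds of the phase algorithm. -/
noncomputable def stateAt (c : Choices G f) (T : Finset V) (x : V → Bool)
    (adv : ℕ → V → Option (Flood V)) (t : ℕ) : V → FloodState V :=
  (phaseAlgorithm c).run G T x adv t

/-- What `v` receives from its neighbours in round `t` of a run. -/
noncomputable def inboxAt (c : Choices G f) (T : Finset V) (x : V → Bool)
    (adv : ℕ → V → Option (Flood V)) (t : ℕ) (v : V) : V → Option (Flood V) := fun w =>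
  open scoped Classical in
  if G.Adj w v then (phaseAlgorithm c).transmit T (adv t) (stateAt c T x adv t) w else none

theorem stateAt_succ (c : Choices G f) (T : Finset V) (x : V → Bool)
    (adv : ℕ → V → Option (Flood V)) (t : ℕ) (v : V) :
    stateAt c T x adv (t + 1) v = phaseStep c v (stateAt c T x adv t v) (inboxAt c T x adv t v) :=
  rfl

theorem phaseStep_of_lt (c : Choices G f) {F : Finset V} {rest : List (Finset V)} {v : V}
    {s : FloodState V} (inbox : V → Option (Flood V)) (hp : s.pending = F :: rest)
    (h : s.round + 1 < Fintype.card V) :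
    phaseStep c v s inbox =
      { pending := F :: rest
        round := s.round + 1
        value := s.value
        received := receivedAfter G v s inbox
        outgoing := accepted G v s inbox } := by
  cases s
  subst hp
  simp only [phaseStep, h, if_true]

theorem phaseStep_of_eq (c : Choices G f) {F : Finset V} {rest : List (Finset V)} {v : V}
    {s : FloodState V} (inbox : V → Option (Flood V)) (hp : s.pending = F :: rest)
    (h : Fintype.card V = s.round + 1) :
    phaseStep c v s inbox =
      startPhase rest (updatedValue c F v s.value (receivedAfter G v s inbox)) := by
  cases s
  subst hp
  simp only [phaseStep, h, lt_irrefl, if_false]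

variable {c : Choices G f} {T : Finset V} {x γ : V → Bool} {adv : ℕ → V → Option (Flood V)}
  {F : Finset V} {rest : List (Finset V)} {t r : ℕ}

theorem inboxAt_of_notMem
    (h : ∀ v, (stateAt c T x adv t v).pending = F :: rest) {v w : V}
    (hadj : G.Adj w v) (hw : w ∉ T) :
    inboxAt c T x adv t v w = some (stateAt c T x adv t w).outgoing := by
  have hp := h w
  refine (if_pos hadj).trans ((if_neg hw).trans ?_)
  change (if (stateAt c T x adv t w).pending.isEmpty then none else _) = _
  rw [hp]
  rfl

theorem inboxInvariant_inboxAt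
    (hstart : ∀ v, stateAt c T x adv t v = startPhase (F :: rest) (γ v))
    (h : ∀ v, FloodInvariant G T γ (initiated T γ (adv t)) (F :: rest) r v
      (stateAt c T x adv (t + r) v)) (v : V) :
    InboxInvariant G T (initiated T γ (adv t)) r v (inboxAt c T x adv (t + r) v) where
  first h0 w hadj := by
    subst h0
    by_cases hw : w ∈ T
    · simp [inboxAt, hadj, Protocol.transmit, hw, initiated]
    · rw [inboxAt_of_notMem (fun v => (h v).pending_eq) hadj hw, initiated_of_notMem hw]
      simp [hstart, startPhase, singleFlood]
  relay w hadj hw p hp hr := by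
    rw [inboxAt_of_notMem (fun v => (h v).pending_eq) hadj hw]
    exact (h w).outgoing_route p hp hr

theorem floodInvariant_run
    (hstart : ∀ v, stateAt c T x adv t v = startPhase (F :: rest) (γ v))
    (hr : r < Fintype.card V) (v : V) :
    FloodInvariant G T γ (initiated T γ (adv t)) (F :: rest) r v
      (stateAt c T x adv (t + r) v) := by
  induction r generalizing v with
  | zero =>
    rw [add_zero, hstart]
    exact floodInvariant_startPhase T γ _ _ v
  | succ r ih =>
    have ih := ih (by omega)
    have hs := ih v
    have hin := inboxInvariant_inboxAt hstart ih v
    have hstep : stateAt c T x adv (t + (r + 1)) v =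
        { pending := F :: rest
          round := r + 1
          value := γ v
          received := receivedAfter G v (stateAt c T x adv (t + r) v)
            (inboxAt c T x adv (t + r) v)
          outgoing := accepted G v (stateAt c T x adv (t + r) v)
            (inboxAt c T x adv (t + r) v) } := by
      rw [← add_assoc, stateAt_succ,
        phaseStep_of_lt c _ hs.pending_eq (by rw [hs.round_eq]; exact hr),
        hs.round_eq, hs.value_eq]
    rw [hstep]
    exact {
      pending_eq := rfl
      round_eq := rfl
      value_eq := rfl
      received_nil := receivedAfter_nil.trans hs.received_nil
      received_route := receivedAfter_route hs hin
      outgoing_route := accepted_route hs hin }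

/-- The outcome of a phase: every node applies the update rule to received values `R v` that agree,
along every path excluding the faulty nodes, with one assignment `b` of initiated values. -/
theorem exists_run_phase [Nonempty V]
    (hstart : ∀ v, stateAt c T x adv t v = startPhase (F :: rest) (γ v)) :
    ∃ (b : V → Bool) (R : V → Flood V), (∀ v ∉ T, b v = γ v) ∧
      (∀ v ∉ T, ∀ w (p : G.Path v w), Excludes p T → valueAlong (R v) p = some (b w)) ∧
      ∀ v, stateAt c T x adv (t + Fintype.card V) v =
        startPhase rest (updatedValue c F v (γ v) (R v)) := by
  obtain ⟨r, hr⟩ := Nat.exists_eq_succ_of_ne_zero (Fintype.card_ne_zero (α := V))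
  have hinv := floodInvariant_run hstart (r := r) (by omega)
  refine ⟨initiated T γ (adv t), fun v => receivedAfter G v
    (stateAt c T x adv (t + r) v) (inboxAt c T x adv (t + r) v),
    fun v hv => initiated_of_notMem hv, fun v hv w p hp => ?_, fun v => ?_⟩
  · have hin := inboxInvariant_inboxAt hstart hinv v
    refine valueAlong_of_excludes (T := T) ?_ (fun q hq hroute hlen => ?_) p hp
    · beta_reduce
      rw [receivedAfter_nil, (hinv v).received_nil, initiated_of_notMem hv]
    · beta_reduce
      rw [receivedAfter_route (hinv v) hin q hq hroute, if_pos (by omega)]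
  · have hs := hinv v
    rw [hr, Nat.succ_eq_add_one, ← add_assoc, stateAt_succ,
      phaseStep_of_eq c _ hs.pending_eq (by rw [hs.round_eq]; exact hr), hs.value_eq]

/-- No phase introduces a value that no non-faulty node held before it. -/
theorem updatedValue_mem {b : V → Bool} {R : Flood V} {v : V} (hT : T.card ≤ f) (hv : v ∉ T)
    (hb : ∀ v ∉ T, b v = γ v)
    (hR : ∀ w (p : G.Path v w), Excludes p T → valueAlong R p = some (b w)) :
    ∃ w ∉ T, γ w = updatedValue c F v (γ v) R := by
  simp only [updatedValue]
  split_ifs with h0 h1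
  · obtain ⟨w, hw, h⟩ := h0.2.exists_initiated hT hv hR
    exact ⟨w, hw, (hb w hw).symm.trans h⟩
  · obtain ⟨w, hw, h⟩ := h1.2.exists_initiated hT hv hR
    exact ⟨w, hw, (hb w hw).symm.trans h⟩
  · exact ⟨v, hv, rfl⟩

theorem sourceSet_eq_or (f : ℕ) (F Z : Finset V) :
    (∀ w, w ∈ sourceSet f F Z ↔ w ∉ Z) ∨ sourceSet f F Z = Z := by
  unfold sourceSet
  split_ifs <;> simp

/-- In the phase whose candidate set is the set of faulty nodes, all non-faulty nodes obtain the
same set `A`, all nodes of which initiated the same value; the non-faulty nodes of `A` keep that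
value, and the others adopt it from a fan. -/
theorem exists_forall_updatedValue_eq [DecidableRel G.Adj] (hdeg : 2 * f ≤ G.minDegree)
    (hconn : IsKConnected G (3 * f / 2 + 1)) (c : Choices G f) (hT : T.card ≤ f)
    {b : V → Bool} {R : V → Flood V} (hb : ∀ v ∉ T, b v = γ v)
    (hR : ∀ v ∉ T, ∀ w (p : G.Path v w), Excludes p T → valueAlong (R v) p = some (b w)) :
    ∃ β, ∀ v ∉ T, updatedValue c T v (γ v) (R v) = β := by
  classical
  let Z : Finset V := Finset.univ.filter fun w => b w = false
  have hZ : ∀ v ∉ T, zeroSet c T v (R v) = Z := by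
    intro v hv
    ext w
    simp [zeroSet, Z, hR v hv w _ (c.excludes T hT v w)]
  obtain ⟨β, hβ⟩ : ∃ β, ∀ w ∈ sourceSet f T Z, b w = β := by
    rcases sourceSet_eq_or f T Z with h | h
    · exact ⟨true, fun w hw => by simpa [Z] using (h w).1 hw⟩
    · exact ⟨false, fun w hw => by
      rw [h] at hw
      exact (Finset.mem_filter.1 hw).2⟩
  have hrec : ∀ v ∉ T, ∀ δ, ReceivesOnDisjointPaths G f T (sourceSet f T Z) v (R v) δ → δ = β := by
    rintro v hv δ ⟨w, p, hp, -⟩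
    obtain ⟨hwA, hex, hval⟩ := hp 0
    rw [hR v hv _ _ hex] at hval
    exact (Option.some_injective _ hval).symm.trans (hβ _ hwA)
  refine ⟨β, fun v hv => ?_⟩
  simp only [updatedValue]
  simp only [hZ v hv]
  split_ifs with h0 h1
  · exact hrec v hv _ h0.2
  · exact hrec v hv _ h1.2
  · by_cases hvA : v ∈ sourceSet f T Z
    · exact (hb v hv).symm.trans (hβ v hvA)
    · obtain ⟨w, p, hp, hdis⟩ := exists_isFan_sourceSet hdeg hconn hT Z hvA hv
      have : ReceivesOnDisjointPaths G f T (sourceSet f T Z) v (R v) β :=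
        ⟨w, p, fun i => ⟨(hp i).1, (hp i).2, by rw [hR v hv _ _ (hp i).2, hβ _ (hp i).1]⟩, hdis⟩
      cases β
      · exact absurd ⟨hvA, this⟩ h0
      · exact absurd ⟨hvA, this⟩ h1

end Phase

/-! ### The whole run -/

section Run

variable {V : Type u} [Fintype V] {G : SimpleGraph V} {f : ℕ}

/-- The remaining phases, from the first round of one of them on.  The last conjunct gives
agreement, either because it holds already or because the faulty set is still to be treated. -/
theorem exists_run_eq_startPhase_nil [DecidableRel G.Adj] [Nonempty V]
    (hdeg : 2 * f ≤ G.minDegree) (hconn : IsKConnected G (3 * f / 2 + 1)) (c : Choices G f)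
    {T : Finset V} (hT : T.card ≤ f) (x : V → Bool) (adv : ℕ → V → Option (Flood V))
    (pending : List (Finset V)) (t : ℕ) (γ : V → Bool)
    (hstart : ∀ v, stateAt c T x adv t v = startPhase pending (γ v)) :
    ∃ (k : ℕ) (γ' : V → Bool),
      (∀ v, stateAt c T x adv (t + k) v = startPhase [] (γ' v)) ∧
      (∀ j < k, ∀ v, (stateAt c T x adv (t + j) v).pending ≠ []) ∧
      (∀ v ∉ T, ∃ w ∉ T, γ w = γ' v) ∧
      ((T ∈ pending ∨ ∃ β, ∀ v ∉ T, γ v = β) → ∃ β, ∀ v ∉ T, γ' v = β) := by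
  induction pending generalizing t γ with
  | nil =>
    exact ⟨0, γ, hstart, by simp, fun v hv => ⟨v, hv, rfl⟩, by simp⟩
  | cons F rest ih =>
    obtain ⟨b, R, hb, hR, hend⟩ := exists_run_phase hstart
    obtain ⟨k, γ', hk, hpend, hval, hagree⟩ := ih _ _ hend
    have hmem : ∀ v ∉ T, ∃ w ∉ T, γ w = updatedValue c F v (γ v) (R v) := fun v hv =>
      updatedValue_mem hT hv hb (hR v hv)
    refine ⟨Fintype.card V + k, γ', fun v => ?_, fun j hj v => ?_, fun v hv => ?_, fun h => ?_⟩
    · rw [← add_assoc]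
      exact hk v
    · by_cases hjn : j < Fintype.card V
      · rw [(floodInvariant_run hstart hjn v).pending_eq]
        exact List.cons_ne_nil _ _
      · have := hpend (j - Fintype.card V) (by omega) v
        rwa [show t + Fintype.card V + (j - Fintype.card V) = t + j by omega] at this
    · obtain ⟨u, hu, hγ⟩ := hval v hv
      obtain ⟨w, hw, hγ'⟩ := hmem u hu
      exact ⟨w, hw, hγ'.trans hγ⟩
    · apply hagree
      rcases h with h | ⟨β, hβ⟩
      · rcases List.mem_cons.1 h with rfl | h
        · exact Or.inr (exists_forall_updatedValue_eq hdeg hconn c hT hb hR)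
        · exact Or.inl h
      · refine Or.inr ⟨β, fun v hv => ?_⟩
        obtain ⟨w, hw, h⟩ := hmem v hv
        rw [← h, hβ w hw]

theorem solvesConsensus_phaseAlgorithm [DecidableRel G.Adj] (hdeg : 2 * f ≤ G.minDegree)
    (hconn : IsKConnected G (3 * f / 2 + 1)) (c : Choices G f) :
    (phaseAlgorithm c).SolvesConsensus G f := by
  intro T hT x adv
  have : Nonempty V := Fintype.card_pos_iff.1 ((Nat.zero_le _).trans_lt hconn.1)
  obtain ⟨k, γ, hk, hpend, hval, hagree⟩ := exists_run_eq_startPhase_nil hdeg hconn c hT x adv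
    c.phases 0 x (fun v => rfl)
  simp only [zero_add, stateAt] at hk hpend
  obtain ⟨β, hβ⟩ := hagree (Or.inl ((c.mem_phases T).2 hT))
  have hout : ∀ v, (phaseAlgorithm c).output v ((phaseAlgorithm c).run G T x adv k v) =
      some (γ v) := by
    intro v
    rw [hk v]
    rfl
  have hnone : ∀ v, ∀ j < k,
      (phaseAlgorithm c).output v ((phaseAlgorithm c).run G T x adv j v) = none := by
    intro v j hj
    have := hpend j hj v
    change (if ((phaseAlgorithm c).run G T x adv j v).pending.isEmpty then _ else none) = none
    simp [this]
  have hdec : ∀ v d, (phaseAlgorithm c).Decides G T x adv v d → γ v = d := by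
    rintro v d ⟨t, ht, hlt⟩
    rcases lt_trichotomy t k with h | rfl | h
    · rw [hnone v t h] at ht
      simp at ht
    · rw [hout v] at ht
      exact Option.some_injective _ ht
    · have := hlt k h
      rw [hout v] at this
      simp at this
  refine ⟨fun v _ => ⟨γ v, k, hout v, hnone v⟩, fun v w hv hw d e hd he => ?_, fun v hv d hd => ?_⟩
  · rw [← hdec v d hd, ← hdec w e he, hβ v hv, hβ w hw]
  · rw [← hdec v d hd]
    exact hval v hv

end Run

end LocalBroadcast

/-- Sufficiency, with the algorithm that achieves consensus. -/
theorem mainTheorem2 {V : Type u} [Fintype V] (G : SimpleGraph V) [DecidableRel G.Adj] (f : ℕ)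
    (hdeg : 2 * f ≤ G.minDegree)
    (hconn : LocalBroadcast.IsKConnected G (3 * f / 2 + 1)) :
    LocalBroadcast.ConsensusAchievable G f ∧
      Nonempty (LocalBroadcast.Choices G f) ∧
      ∀ c : LocalBroadcast.Choices G f,
        (LocalBroadcast.phaseAlgorithm c).SolvesConsensus G f := by
  have hsolves := LocalBroadcast.solvesConsensus_phaseAlgorithm hdeg hconn
  obtain ⟨c⟩ := LocalBroadcast.nonempty_choices hconn
  exact ⟨⟨_, hsolves c⟩, ⟨c⟩, hsolves⟩
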